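/- Let $A\neq 0$ be a square real or complex matrix, $b$ a vector, $\|A\|_\infty$ the maximal absolute row sum, $\|b\|_\infty$ the maximum norm, and let $p\ge 0$ and $n$ be integers. Let $$I_{p+1}=\varphi_{p+1}(A)b,\qquad \varphi_{p+1}(A)=\int_0^1 e^{(1-\theta)A}\frac{\theta^{p}}{p!}\,d\theta .$$ For a quadrature rule on $[0,1]$ with nodes $x_1,\dots,x_{n+1}$ and weights $w_1,\dots,w_{n+1}$, let $$\hat I_{p+1}=\sum_{i=1}^{n+1}w_i\frac{x_i^{p}}{p!}\,v_i,\qquad v_i=e^{(1-x_i)A}b .$$ The rule is either the $(n+1)$-point Clenshaw–Curtis rule (the interpolatory rule at the points $\cos(j\pi/n)$, $j=0,\dots,n$, mapped from $[-1,1]$ to $[0,1]$) or the $(n+1)$-point Gauss–Legendre rule on $[0,1]$; both indeed have $n+1$ distinct nodes for the $n$ below. If $A=A^x\otimes I^y+I^x\otimes A^y$ and $b=\mathrm{vec}(B)$, the $v_i$ may be computed as $\mathrm{vec}\big(e^{(1-x_i)A^y}B(e^{(1-x_i)A^x})^T\big)$; if $A=A^x\otimes I^y\otimes I^z+I^x\otimes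 A^y\otimes I^z+I^x\otimes I^y\otimes A^z$ and $b=\mathrm{vec}(B)$ for a tensor $B$ of order 3, they may be computed as $\mathrm{vec}\big(B\times_1e^{(1-x_i)A^x}\times_2e^{(1-x_i)A^y}\times_3e^{(1-x_i)A^z}\big)$, where $\times_d$ is the product along the $d$-th mode and $\mathrm{vec}$ orders the entries compatibly with $\otimes$. In all these cases the following holds. Let $$M(\rho)=\frac{g(\rho)^p}{2^{p+1}p!}\,e^{\frac12 g(\rho)\|A\|_\infty}\|b\|_\infty,\qquad g(\rho)=\frac{(\rho+1)^2}{2\rho},$$ and consider the quartic equation $\rho^4+a_3\rho^3+a_2\rho^2+a_1\rho+1=0$ with $a_2=-(2+8p\|A\|_\infty^{-1})$ and - Clenshaw–Curtis: $a_3=-4\|A\|_\infty^{-1}(n+1-p)$, $a_1=4\|A\|_\infty^{-1}(n-1+p)$; - Gauss: $a_3=-4\|A\|_\infty^{-1}(2(n+1)-p)$, $a_1=4\|A\|_\infty^{-1}(2n+p)$. 1. (Clenshaw–Curtis, $n\ge4$.) The quartic has a real root $\bar\rho>1$, and for every such root $$\|I_{p+1}-\hat I_{p+1}\|_\infty\le\frac{144}{35}\,\frac{M(\bar\rho)\,\bar\rho^{\,1-n}}{\bar\rho^2-1}.$$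 If $n$ is even, the quartic with $n$ replaced by $n+1$ in its coefficients also has a real root $\bar\rho>1$, and the bound with $\bar\rho^{\,1-n}$ improved to $\bar\rho^{\,-n}$ holds for every real root $\bar\rho>1$ of either quartic. 2. (Gauss, $n\ge2$.) The quartic has a real root $\bar\rho>1$, and for every such root $$\|I_{p+1}-\hat I_{p+1}\|_\infty\le\frac{144}{35}\,\frac{M(\bar\rho)\,\bar\rho^{\,-2n}}{\bar\rho^2-1}.$$ -/

import Mathlib

open scoped Kronecker Matrix.Norms.Operator Nat
open Polynomial

noncomputable section

namespace PhiQuad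

/-! With `Matrix.Norms.Operator` open, the norm of a matrix is `‖A‖_∞` (the maximal absolute row
sum), and the norm of a vector `ι → 𝕜` is the maximum norm `‖b‖_∞`. -/

section PhiFunctions

variable {𝕜 : Type*} [RCLike 𝕜] {ι : Type*} [Fintype ι] [DecidableEq ι]

/-- The `φ`-functions of a matrix: `φ_0(A) = e^A` and
`φ_p(A) = ∫_0^1 e^{(1-θ)A} θ^{p-1}/(p-1)! dθ` for `p ≥ 1`. -/
def phi : ℕ → Matrix ι ι 𝕜 → Matrix ι ι 𝕜
  | 0, A => NormedSpace.exp A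
  | p + 1, A => ∫ θ in (0 : ℝ)..1, (θ ^ p / (p ! : ℝ)) • NormedSpace.exp ((1 - θ) • A)

end PhiFunctions

/-! ### Quadrature rules on `[0, 1]` -/

/-- A quadrature rule: a finite set of nodes, and a weight for each node
(the values of `weight` outside `nodes` are never used). -/
structure QuadratureRule where
  nodes : Finset ℝ
  weight : ℝ → ℝ

/-- The interpolatory rule on `[0, 1]` with given nodes: the weight of the node `x` is the integral
over `[0, 1]` of the Lagrange basis polynomial that is `1` at `x` and `0` at the other nodes. -/
def interpolatoryRule (s : Finset ℝ) : QuadratureRule where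
  nodes := s
  weight x := ∫ t in (0 : ℝ)..1, (Lagrange.basis s id x).eval t

/-- The `(n+1)`-point Clenshaw-Curtis rule on `[0, 1]` (`n ≥ 1`): the interpolatory rule at the
Chebyshev points `cos (jπ/n)`, `j = 0, …, n`, mapped from `[-1, 1]` to `[0, 1]`. -/
def clenshawCurtis (n : ℕ) : QuadratureRule :=
  interpolatoryRule
    ((Finset.range (n + 1)).image fun j : ℕ => (1 + Real.cos (j * Real.pi / n)) / 2)

/-- The `(n+1)`-point Gauss-Legendre rule on `[0, 1]`: the interpolatory rule at the roots of the
Legendre polynomial of degree `n + 1`, shifted to `[0, 1]`. -/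
def gaussLegendre (n : ℕ) : QuadratureRule :=
  interpolatoryRule ((shiftedLegendre (n + 1)).map (Int.castRingHom ℝ)).roots.toFinset

/-! ### The fixed-point quadrature algorithm -/

section Algorithm

variable {𝕜 : Type*} [RCLike 𝕜] {ι ιx ιy ιz : Type*} [Fintype ι] [DecidableEq ι]
  [Fintype ιx] [DecidableEq ιx] [Fintype ιy] [DecidableEq ιy] [Fintype ιz] [DecidableEq ιz]

/-- The output `y_j = ∑_i w_i x_i^{j-1}/(j-1)! v_i` (`j ≥ 1`) of the algorithm for a quadrature rule
`{(w_i, x_i)}`, where `v x` is the vector computed at the node `x` for `e^{(1-x)A} b`. -/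
def algorithmOne (Q : QuadratureRule) (v : ℝ → ι → 𝕜) (j : ℕ) : ι → 𝕜 :=
  ∑ x ∈ Q.nodes, (Q.weight x * (x ^ (j - 1) / ((j - 1)! : ℝ))) • v x

/-- The vectors `v = e^{(1-x)A} b`, for a matrix `A` without assumed structure. -/
def expAction (A : Matrix ι ι 𝕜) (b : ι → 𝕜) (x : ℝ) : ι → 𝕜 :=
  (NormedSpace.exp ((1 - x) • A)).mulVec b

/-- The Kronecker sum `A^x ⊗ I^y + I^x ⊗ A^y`. -/
def kronSum₂ (Ax : Matrix ιx ιx 𝕜) (Ay : Matrix ιy ιy 𝕜) : Matrix (ιx × ιy) (ιx × ιy) 𝕜 :=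
  Ax ⊗ₖ (1 : Matrix ιy ιy 𝕜) + (1 : Matrix ιx ιx 𝕜) ⊗ₖ Ay

/-- The vectors `v = vec V`, `V = e^{(1-x)A^y} B (e^{(1-x)A^x})ᵀ`, which use only exponentials of
the one-dimensional matrices; here `b = vec B`. -/
def kronExpAction₂ (Ax : Matrix ιx ιx 𝕜) (Ay : Matrix ιy ιy 𝕜) (B : Matrix ιy ιx 𝕜) (x : ℝ) :
    ιx × ιy → 𝕜 :=
  (NormedSpace.exp ((1 - x) • Ay) * B * (NormedSpace.exp ((1 - x) • Ax)).transpose).vec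

/-- The Kronecker sum `A^x ⊗ I^y ⊗ I^z + I^x ⊗ A^y ⊗ I^z + I^x ⊗ I^y ⊗ A^z`. -/
def kronSum₃ (Ax : Matrix ιx ιx 𝕜) (Ay : Matrix ιy ιy 𝕜) (Az : Matrix ιz ιz 𝕜) :
    Matrix ((ιx × ιy) × ιz) ((ιx × ιy) × ιz) 𝕜 :=
  Ax ⊗ₖ (1 : Matrix ιy ιy 𝕜) ⊗ₖ (1 : Matrix ιz ιz 𝕜)
    + (1 : Matrix ιx ιx 𝕜) ⊗ₖ Ay ⊗ₖ (1 : Matrix ιz ιz 𝕜)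
    + (1 : Matrix ιx ιx 𝕜) ⊗ₖ (1 : Matrix ιy ιy 𝕜) ⊗ₖ Az

/-- Vectorization of a tensor of order 3, indexed as in `kronSum₃`. -/
def vec₃ (B : ιx → ιy → ιz → 𝕜) : (ιx × ιy) × ιz → 𝕜 := fun i => B i.1.1 i.1.2 i.2

/-- The product `B ×₁ M` of a tensor and a matrix along the first mode. -/
def modeProd₁ (B : ιx → ιy → ιz → 𝕜) (M : Matrix ιx ιx 𝕜) : ιx → ιy → ιz → 𝕜 :=
  fun i j k => ∑ l, M i l * B l j k

/-- The product `B ×₂ M` of a tensor and a matrix along the second mode. -/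
def modeProd₂ (B : ιx → ιy → ιz → 𝕜) (M : Matrix ιy ιy 𝕜) : ιx → ιy → ιz → 𝕜 :=
  fun i j k => ∑ l, M j l * B i l k

/-- The product `B ×₃ M` of a tensor and a matrix along the third mode. -/
def modeProd₃ (B : ιx → ιy → ιz → 𝕜) (M : Matrix ιz ιz 𝕜) : ιx → ιy → ιz → 𝕜 :=
  fun i j k => ∑ l, M k l * B i j l

/-- The vectors `v = vec V`, `V = B ×₁ e^{(1-x)A^x} ×₂ e^{(1-x)A^y} ×₃ e^{(1-x)A^z}`, which use only
exponentials of the one-dimensional matrices; here `b = vec B`. -/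
def kronExpAction₃ (Ax : Matrix ιx ιx 𝕜) (Ay : Matrix ιy ιy 𝕜) (Az : Matrix ιz ιz 𝕜)
    (B : ιx → ιy → ιz → 𝕜) (x : ℝ) : (ιx × ιy) × ιz → 𝕜 :=
  vec₃ (modeProd₃ (modeProd₂ (modeProd₁ B (NormedSpace.exp ((1 - x) • Ax)))
    (NormedSpace.exp ((1 - x) • Ay))) (NormedSpace.exp ((1 - x) • Az)))

end Algorithm

/-! ### The error bounds; `α` stands for `‖A‖_∞` and `β` for `‖b‖_∞` -/

/-- `g(ρ) = (ρ+1)²/(2ρ)`. -/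
def g (ρ : ℝ) : ℝ := (ρ + 1) ^ 2 / (2 * ρ)

/-- `M(ρ) = g(ρ)^p/(2^{p+1} p!) e^{g(ρ)α/2} β`. -/
def M (p : ℕ) (α β ρ : ℝ) : ℝ :=
  g ρ ^ p / (2 ^ (p + 1) * (p ! : ℝ)) * Real.exp (1 / 2 * g ρ * α) * β

/-- `(144/35) M(ρ) ρ^{1-n}/(ρ²-1)`. -/
def ccBound (p n : ℕ) (α β ρ : ℝ) : ℝ :=
  144 / 35 * (M p α β ρ * ρ ^ (1 - (n : ℤ)) / (ρ ^ 2 - 1))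

/-- `(144/35) M(ρ) ρ^{-2n}/(ρ²-1)`. -/
def gaussBound (p n : ℕ) (α β ρ : ℝ) : ℝ :=
  144 / 35 * (M p α β ρ * ρ ^ (-2 * (n : ℤ)) / (ρ ^ 2 - 1))

/-- The quartic for Clenshaw-Curtis quadrature: `X⁴ + a₃X³ + a₂X² + a₁X + 1` with
`a₃ = -4α⁻¹(n+1-p)`, `a₂ = -(2+8pα⁻¹)`, `a₁ = 4α⁻¹(n-1+p)`. -/
def ccQuartic (p n : ℕ) (α : ℝ) : ℝ[X] :=
  X ^ 4 + C (-4 * α⁻¹ * ((n : ℝ) + 1 - p)) * X ^ 3 + C (-(2 + 8 * p * α⁻¹)) * X ^ 2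
    + C (4 * α⁻¹ * ((n : ℝ) - 1 + p)) * X + 1

/-- The quartic for Gauss quadrature: `X⁴ + a₃X³ + a₂X² + a₁X + 1` with
`a₃ = -4α⁻¹(2(n+1)-p)`, `a₂ = -(2+8pα⁻¹)`, `a₁ = 4α⁻¹(2n+p)`. -/
def gaussQuartic (p n : ℕ) (α : ℝ) : ℝ[X] :=
  X ^ 4 + C (-4 * α⁻¹ * (2 * ((n : ℝ) + 1) - p)) * X ^ 3 + C (-(2 + 8 * p * α⁻¹)) * X ^ 2
    + C (4 * α⁻¹ * (2 * (n : ℝ) + p)) * X + 1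

/-- The full claim on the approximation of `φ_{p+1}(A) b` with `n + 1` nodes, where `v x` is the
vector that the algorithm computes at the node `x`: each of the two rules has `n + 1` nodes, its
quartic has a real root `ρ > 1`, and the error bound holds for every such root; for
Clenshaw-Curtis quadrature with even `n` the bound also holds with `n` replaced by `n + 1`, be it in
the bound and in the quartic, or in the bound alone. -/
def ErrorBounds {𝕜 : Type*} [RCLike 𝕜] {ι : Type*} [Fintype ι] [DecidableEq ι]
    (p n : ℕ) (A : Matrix ι ι 𝕜) (b : ι → 𝕜) (v : ℝ → ι → 𝕜) : Prop :=
  (4 ≤ n →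
    (clenshawCurtis n).nodes.card = n + 1 ∧
    (∃ ρ : ℝ, 1 < ρ ∧ (ccQuartic p n ‖A‖).IsRoot ρ) ∧
    (∀ ρ : ℝ, 1 < ρ → (ccQuartic p n ‖A‖).IsRoot ρ →
      ‖(phi (p + 1) A).mulVec b - algorithmOne (clenshawCurtis n) v (p + 1)‖
        ≤ ccBound p n ‖A‖ ‖b‖ ρ) ∧
    (Even n →
      (∃ ρ : ℝ, 1 < ρ ∧ (ccQuartic p (n + 1) ‖A‖).IsRoot ρ) ∧
      (∀ ρ : ℝ, 1 < ρ →
        ((ccQuartic p (n + 1) ‖A‖).IsRoot ρ ∨ (ccQuartic p n ‖A‖).IsRoot ρ) →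
        ‖(phi (p + 1) A).mulVec b - algorithmOne (clenshawCurtis n) v (p + 1)‖
          ≤ ccBound p (n + 1) ‖A‖ ‖b‖ ρ))) ∧
  (2 ≤ n →
    (gaussLegendre n).nodes.card = n + 1 ∧
    (∃ ρ : ℝ, 1 < ρ ∧ (gaussQuartic p n ‖A‖).IsRoot ρ) ∧
    (∀ ρ : ℝ, 1 < ρ → (gaussQuartic p n ‖A‖).IsRoot ρ →
      ‖(phi (p + 1) A).mulVec b - algorithmOne (gaussLegendre n) v (p + 1)‖
        ≤ gaussBound p n ‖A‖ ‖b‖ ρ))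

end PhiQuad

end

noncomputable section

namespace PhiQuad

/-! ### The error functional of a quadrature rule on polynomials -/

/-! Everything reduces to the scalar error functional `E` (integral minus rule) on polynomials.
Expanding `e^{(1-θ)A} b` in powers of `(1-θ)A` turns the error vector into the sum over `k` of
`E(x^p (1-x)^k) / (p! k!) • A^k b`, so it suffices to bound `E` on `x^p (1-x)^k`.

For this, no complex analysis is needed. Multiplication by `x` or by `1-x` acts on the shifted
Chebyshev polynomials as a three-term recurrence with absolute coefficients `1/4, 1/2, 1/4`. The
sequence `m ↦ (ρ^m + ρ^{-m})/2` is an eigenvector of that recurrence with eigenvalue `g(ρ)/2`. Hence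
a bound `B (ρ^m + ρ^{-m})/2` for `E` on the Chebyshev basis propagates to `B (g(ρ)/2)^{p+k}`
(`abs_apply_X_pow_mul_one_sub_X_pow_le`). Summing the exponential series gives `2 B M(ρ)`
(`norm_phi_sub_algorithmOne_le`).

On the Chebyshev basis (`QuadratureRule.abs_error_shiftedT_le`), `E` vanishes in odd degree by
symmetry and in even degree below some `K ≥ 6` by exactness. In the remaining even degrees the
integral is at most `1/35` and the rule at most `1` in absolute value, so `B = 72/35 ρ^{-K}` works.
The bound on the rule comes from aliasing for Clenshaw-Curtis and from positive weights for Gauss.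

The estimate holds for every `ρ > 1`. The quartic is the condition that the bound be stationary in
`ρ`; that it has a root beyond `1` follows from its negative value at `1`. For Kronecker sums the
exponential factors, so the vectors computed at the nodes are the same. -/

/-- The integral over `[0, 1]` as a linear functional on polynomials. -/
def unitIntegral : ℝ[X] →ₗ[ℝ] ℝ where
  toFun q := ∫ t in (0 : ℝ)..1, q.eval t
  map_add' q r := by
    simp only [eval_add]
    exact intervalIntegral.integral_add (q.continuous.intervalIntegrable _ _)
      (r.continuous.intervalIntegrable _ _)
  map_smul' c q := by simp

theorem unitIntegral_apply (q : ℝ[X]) : unitIntegral q = ∫ t in (0 : ℝ)..1, q.eval t := rfl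

/-- The value of a quadrature rule, as a linear functional on polynomials. -/
def QuadratureRule.value (Q : QuadratureRule) : ℝ[X] →ₗ[ℝ] ℝ :=
  ∑ x ∈ Q.nodes, Q.weight x • leval x

theorem QuadratureRule.value_apply (Q : QuadratureRule) (q : ℝ[X]) :
    Q.value q = ∑ x ∈ Q.nodes, Q.weight x * q.eval x := by
  simp [QuadratureRule.value, LinearMap.sum_apply]

/-- The error of a quadrature rule, as a linear functional on polynomials. -/
def QuadratureRule.error (Q : QuadratureRule) : ℝ[X] →ₗ[ℝ] ℝ := unitIntegral - Q.value

theorem QuadratureRule.error_apply (Q : QuadratureRule) (q : ℝ[X]) :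
    Q.error q = unitIntegral q - Q.value q := rfl

theorem unitIntegral_nonneg {q : ℝ[X]} (h : ∀ t ∈ Set.Icc (0 : ℝ) 1, 0 ≤ q.eval t) :
    0 ≤ unitIntegral q :=
  intervalIntegral.integral_nonneg zero_le_one h

theorem unitIntegral_C (c : ℝ) : unitIntegral (C c) = c := by
  simp [unitIntegral_apply]

theorem abs_unitIntegral_le {q : ℝ[X]} {c : ℝ} (h : ∀ t ∈ Set.Icc (0 : ℝ) 1, |q.eval t| ≤ c) :
    |unitIntegral q| ≤ c := by
  have := intervalIntegral.norm_integral_le_of_norm_le_const (a := (0 : ℝ)) (b := 1)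
    (f := fun t => q.eval t) (C := c) (fun t ht => by
      rw [Set.uIoc_of_le zero_le_one] at ht
      exact h t ⟨ht.1.le, ht.2⟩)
  simpa [unitIntegral_apply] using this

theorem unitIntegral_comp_one_sub_X (q : ℝ[X]) :
    unitIntegral (q.comp (1 - X)) = unitIntegral q := by
  have := intervalIntegral.integral_comp_sub_left (a := (0 : ℝ)) (b := 1)
    (fun t => q.eval t) (1 : ℝ)
  simpa [unitIntegral_apply] using this

theorem unitIntegral_derivative (q : ℝ[X]) :
    unitIntegral (derivative q) = q.eval 1 - q.eval 0 := by
  rw [unitIntegral_apply]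
  exact intervalIntegral.integral_eq_sub_of_hasDerivAt (fun t _ => q.hasDerivAt t)
    ((derivative q).continuous.intervalIntegrable _ _)

/-! ### Shifted Chebyshev polynomials -/

/-- The Chebyshev polynomial `T_m(2X - 1)` on `[0, 1]`. -/
def shiftedT (m : ℤ) : ℝ[X] := (Chebyshev.T ℝ m).comp (2 * X - 1)

theorem eval_shiftedT (m : ℤ) (x : ℝ) :
    (shiftedT m).eval x = (Chebyshev.T ℝ m).eval (2 * x - 1) := by
  simp [shiftedT]

theorem natDegree_shiftedT (m : ℤ) : (shiftedT m).natDegree = m.natAbs := by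
  have h : ((2 : ℝ[X]) * X - 1).natDegree = 1 := by
    have : ((2 : ℝ[X]) * X - 1) = C 2 * X + C (-1) := by
      rw [map_neg, map_one, sub_eq_add_neg, map_ofNat]
    rw [this, natDegree_linear two_ne_zero]
  rw [shiftedT, natDegree_comp, h, mul_one]
  exact natDegree_eq_of_degree_eq_some (Chebyshev.degree_T ℝ m)

theorem shiftedT_zero : shiftedT 0 = 1 := by simp [shiftedT]

/-- Write `x = (1 + y)/2` with `y = 2x - 1` and use `2y T_m(y) = T_{m+1}(y) + T_{m-1}(y)`. Integer
indices make this valid at `m = 0` too. -/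
theorem X_mul_shiftedT (m : ℤ) : X * shiftedT m =
    (1 / 2 : ℝ) • shiftedT m + (1 / 4 : ℝ) • (shiftedT (m + 1) + shiftedT (m - 1)) := by
  refine Polynomial.funext fun x => ?_
  simp only [eval_mul, eval_X, eval_add, eval_smul, smul_eq_mul, eval_shiftedT,
    Chebyshev.T_add_one, eval_sub, eval_ofNat]
  ring

theorem one_sub_X_mul_shiftedT (m : ℤ) : (1 - X) * shiftedT m =
    (1 / 2 : ℝ) • shiftedT m - (1 / 4 : ℝ) • (shiftedT (m + 1) + shiftedT (m - 1)) := by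
  rw [sub_mul, one_mul, X_mul_shiftedT]
  module

theorem shiftedT_comp_one_sub_X {m : ℤ} (hm : Odd m) :
    (shiftedT m).comp (1 - X) = -shiftedT m := by
  refine Polynomial.funext fun x => ?_
  have : 2 * (1 - x) - 1 = -(2 * x - 1) := by ring
  simp only [eval_comp, eval_shiftedT, eval_sub, eval_one, eval_X, eval_neg, this,
    Chebyshev.T_eval_neg, Int.negOnePow_odd m hm]
  simp

theorem abs_eval_shiftedT_le_one (m : ℤ) {t : ℝ} (ht : t ∈ Set.Icc (0 : ℝ) 1) :
    |(shiftedT m).eval t| ≤ 1 := by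
  rw [eval_shiftedT]
  exact Chebyshev.abs_eval_T_real_le_one m (abs_le.2 ⟨by linarith [ht.1], by linarith [ht.2]⟩)

theorem unitIntegral_shiftedT_of_odd {m : ℤ} (hm : Odd m) : unitIntegral (shiftedT m) = 0 := by
  have := unitIntegral_comp_one_sub_X (shiftedT m)
  rw [shiftedT_comp_one_sub_X hm, map_neg] at this
  linarith

theorem abs_unitIntegral_shiftedT_le_one (m : ℤ) : |unitIntegral (shiftedT m)| ≤ 1 :=
  abs_unitIntegral_le fun _ => abs_eval_shiftedT_le_one m

theorem derivative_shiftedT (m : ℤ) : derivative (shiftedT m) =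
    (2 * m : ℝ) • (Chebyshev.U ℝ (m - 1)).comp (2 * X - 1) := by
  refine Polynomial.funext fun x => ?_
  simp [shiftedT, derivative_comp, Chebyshev.T_derivative_eq_U]
  ring

theorem unitIntegral_shiftedT_of_even {m : ℤ} (hm : Even m) :
    unitIntegral (shiftedT m) = -1 / ((m : ℝ) ^ 2 - 1) := by
  have h1 : (m : ℝ) + 1 ≠ 0 := by
    intro h
    have : m + 1 = 0 := by exact_mod_cast h
    grind
  have h2 : (m : ℝ) - 1 ≠ 0 := by
    intro h
    have : m - 1 = 0 := by exact_mod_cast h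
    grind
  -- The antiderivative comes from `2 T_m = U_m - U_{m-2}` and `T_k' = k U_{k-1}`; the `4` combines
  -- this `2` with the `2` of the substitution `2x - 1`.
  have key : shiftedT m = derivative
      ((1 / (4 * ((m : ℝ) + 1))) • shiftedT (m + 1) - (1 / (4 * ((m : ℝ) - 1))) • shiftedT (m - 1)) := by
    have hU := Chebyshev.two_mul_T_eq_U_sub_U ℝ (m - 2)
    refine Polynomial.funext fun x => ?_
    have hx := congrArg (eval (2 * x - 1)) hU
    simp only [eval_mul, eval_sub, eval_ofNat, sub_add_cancel] at hx
    simp only [derivative_sub, derivative_smul, derivative_shiftedT, eval_sub, eval_smul,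
      smul_eq_mul, eval_comp, eval_mul, eval_ofNat, eval_X, eval_one, add_sub_cancel_right,
      eval_shiftedT]
    rw [show m - 1 - 1 = m - 2 by ring]
    push_cast
    field_simp
    linear_combination 2 * hx
  have ho : Odd (m + 1) := hm.add_one
  have ho' : Odd (m - 1) := hm.sub_odd odd_one
  rw [key, unitIntegral_derivative]
  simp only [eval_sub, eval_smul, eval_shiftedT, smul_eq_mul]
  norm_num [Chebyshev.T_eval_one, Chebyshev.T_eval_neg_one, Int.negOnePow_odd _ ho,
    Int.negOnePow_odd _ ho']
  have h3 : (m : ℝ) ^ 2 - 1 ≠ 0 := by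
    rw [show (m : ℝ) ^ 2 - 1 = (m + 1) * (m - 1) by ring]
    exact mul_ne_zero h1 h2
  field_simp
  ring

/-- The constant is `35 = 6² - 1`. -/
theorem abs_unitIntegral_shiftedT_le {m : ℤ} (hm : Even m) (h6 : 6 ≤ m.natAbs) :
    |unitIntegral (shiftedT m)| ≤ 1 / 35 := by
  have h : (36 : ℝ) ≤ (m : ℝ) ^ 2 := by
    have : (6 : ℝ) ≤ |(m : ℝ)| := by
      rw [← Int.cast_abs, Int.abs_eq_natAbs]
      exact_mod_cast h6
    rw [← sq_abs]
    nlinarith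
  rw [unitIntegral_shiftedT_of_even hm, abs_div, abs_neg, abs_one,
    abs_of_pos (by linarith : (0 : ℝ) < (m : ℝ) ^ 2 - 1)]
  exact one_div_le_one_div_of_le (by norm_num) (by linarith)

/-! ### Functionals bounded on the Chebyshev basis -/

/-- A functional that is bounded on the shifted Chebyshev polynomials by a multiple of
`(ρ^m + ρ^{-m})/2` is bounded on `x^p (1-x)^k` by that multiple of `(g(ρ)/2)^{p+k}`. -/
theorem abs_apply_X_pow_mul_one_sub_X_pow_le {ρ : ℝ} (hρ : 0 < ρ) (p k : ℕ) :
    ∀ (F : ℝ[X] →ₗ[ℝ] ℝ) (B : ℝ),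
      (∀ m : ℤ, |F (shiftedT m)| ≤ B * ((ρ ^ m + ρ ^ (-m)) / 2)) →
      |F (X ^ p * (1 - X) ^ k)| ≤ B * (g ρ / 2) ^ (p + k) := by
  have step (F : ℝ[X] →ₗ[ℝ] ℝ) (B : ℝ)
      (hF : ∀ m : ℤ, |F (shiftedT m)| ≤ B * ((ρ ^ m + ρ ^ (-m)) / 2)) (m : ℤ) :
      1 / 2 * |F (shiftedT m)| + 1 / 4 * (|F (shiftedT (m + 1))| + |F (shiftedT (m - 1))|) ≤
        B * (g ρ / 2) * ((ρ ^ m + ρ ^ (-m)) / 2) := by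
    -- The eigenvector identity: `1/2 + (ρ + ρ⁻¹)/4 = (ρ + 1)²/(4ρ) = g(ρ)/2`.
    have e : B * (g ρ / 2) * ((ρ ^ m + ρ ^ (-m)) / 2) =
        1 / 2 * (B * ((ρ ^ m + ρ ^ (-m)) / 2)) +
        1 / 4 * (B * ((ρ ^ (m + 1) + ρ ^ (-(m + 1))) / 2) +
          B * ((ρ ^ (m - 1) + ρ ^ (-(m - 1))) / 2)) := by
      rw [neg_add', neg_sub', zpow_add₀ hρ.ne', zpow_sub₀ hρ.ne', zpow_sub₀ hρ.ne',
        sub_neg_eq_add, zpow_add₀ hρ.ne', zpow_one, g]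
      field_simp
      ring
    rw [e]
    have := hF m
    have := hF (m + 1)
    have := hF (m - 1)
    linarith
  induction p with
  | zero =>
    induction k with
    | zero =>
      intro F B hF
      simpa [shiftedT_zero] using hF 0
    | succ k ih =>
      intro F B hF
      -- Peeling off one factor replaces the functional by its composite with that multiplication,
      -- at the cost of a factor `g(ρ)/2` in the constant; hence the induction is over all
      -- functionals and constants.
      have := ih (F ∘ₗ LinearMap.mulLeft ℝ (1 - X)) (B * (g ρ / 2)) fun m => by
        refine le_trans ?_ (step F B hF m)
        simp only [LinearMap.comp_apply, LinearMap.mulLeft_apply, one_sub_X_mul_shiftedT, map_sub,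
          map_smul, map_add, smul_eq_mul]
        refine (abs_sub _ _).trans ?_
        rw [abs_mul, abs_mul, abs_of_pos (by norm_num : (0 : ℝ) < 1 / 2),
          abs_of_pos (by norm_num : (0 : ℝ) < 1 / 4)]
        gcongr
        exact abs_add_le _ _
      calc |F (X ^ 0 * (1 - X) ^ (k + 1))|
          = |F ((1 - X) * (X ^ 0 * (1 - X) ^ k))| := by congr 2; ring
        _ ≤ B * (g ρ / 2) * (g ρ / 2) ^ (0 + k) := this
        _ = _ := by ring
  | succ p ih =>
    intro F B hF
    have := ih (F ∘ₗ LinearMap.mulLeft ℝ X) (B * (g ρ / 2)) fun m => by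
      refine le_trans ?_ (step F B hF m)
      simp only [LinearMap.comp_apply, LinearMap.mulLeft_apply, X_mul_shiftedT,
        map_smul, map_add, smul_eq_mul]
      refine (abs_add_le _ _).trans ?_
      rw [abs_mul, abs_mul, abs_of_pos (by norm_num : (0 : ℝ) < 1 / 2),
        abs_of_pos (by norm_num : (0 : ℝ) < 1 / 4)]
      gcongr
      exact abs_add_le _ _
    calc |F (X ^ (p + 1) * (1 - X) ^ k)|
        = |F (X * (X ^ p * (1 - X) ^ k))| := by congr 2; ring
      _ ≤ B * (g ρ / 2) * (g ρ / 2) ^ (p + k) := this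
      _ = _ := by ring

/-! ### Interpolatory rules -/

theorem interpolatoryRule_value (s : Finset ℝ) (q : ℝ[X]) :
    (interpolatoryRule s).value q =
      unitIntegral (Lagrange.interpolate s id fun x => q.eval x) := by
  rw [QuadratureRule.value_apply, Lagrange.interpolate_apply, map_sum]
  refine Finset.sum_congr rfl fun x _ => ?_
  rw [← smul_eq_C_mul, map_smul, smul_eq_mul, mul_comm]
  rfl

theorem interpolatoryRule_value_of_degree_lt {s : Finset ℝ} {q : ℝ[X]}
    (hq : q.degree < s.card) : (interpolatoryRule s).value q = unitIntegral q := by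
  rw [interpolatoryRule_value]
  congr 1
  exact (Lagrange.eq_interpolate (Function.injective_id.injOn) hq).symm

/-- Reflecting the interpolant of `q` gives the interpolant of the reflected `q`, by uniqueness, and
the integral is invariant under reflection. -/
theorem interpolatoryRule_value_comp_one_sub_X {s : Finset ℝ} (hs : ∀ x ∈ s, 1 - x ∈ s)
    (q : ℝ[X]) :
    (interpolatoryRule s).value (q.comp (1 - X)) = (interpolatoryRule s).value q := by
  rw [interpolatoryRule_value, interpolatoryRule_value,
    ← unitIntegral_comp_one_sub_X (Lagrange.interpolate s id fun x => q.eval x)]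
  congr 1
  have hinj : Set.InjOn (id : ℝ → ℝ) s := Function.injective_id.injOn
  symm
  refine Lagrange.eq_interpolate_of_eval_eq _ hinj ?_ fun x hx => ?_
  · set r := Lagrange.interpolate s id fun x => q.eval x
    have hr : r.degree < s.card := Lagrange.degree_interpolate_lt _ hinj
    rcases eq_or_ne r 0 with h0 | h0
    · simp [h0]
    · have h1 : ((1 : ℝ[X]) - X).natDegree = 1 := by
        rw [show ((1 : ℝ[X]) - X) = -(X - C 1) by simp, natDegree_neg, natDegree_X_sub_C]
      have : (r.comp (1 - X)).natDegree = r.natDegree := by rw [natDegree_comp, h1, mul_one]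
      refine lt_of_le_of_lt degree_le_natDegree ?_
      rw [this]
      exact (degree_eq_natDegree h0) ▸ hr
  · have := Lagrange.eval_interpolate_at_node (v := id) (fun x => q.eval x) hinj (hs x hx)
    simp only [eval_comp, eval_sub, eval_one, eval_X, id]
    exact this

/-- A rule that is exact on the shifted Chebyshev polynomials of degree less than `K`, vanishes on
the odd ones, and is at most `1` on the even ones, has an error functional with the bound that
`abs_apply_X_pow_mul_one_sub_X_pow_le` needs. -/
theorem QuadratureRule.abs_error_shiftedT_le {Q : QuadratureRule} {K : ℕ} {ρ : ℝ} (hK : 6 ≤ K)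
    (hρ : 1 < ρ) (hexact : ∀ m : ℤ, Even m → m.natAbs < K → Q.error (shiftedT m) = 0)
    (hodd : ∀ m : ℤ, Odd m → Q.value (shiftedT m) = 0)
    (heven : ∀ m : ℤ, Even m → |Q.value (shiftedT m)| ≤ 1) (m : ℤ) :
    |Q.error (shiftedT m)| ≤ 72 / 35 * (ρ ^ K)⁻¹ * ((ρ ^ m + ρ ^ (-m)) / 2) := by
  have h0 : 0 < ρ := by linarith
  have hpos : 0 ≤ 72 / 35 * (ρ ^ K)⁻¹ * ((ρ ^ m + ρ ^ (-m)) / 2) := by positivity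
  rcases Int.even_or_odd m with hm | hm
  · by_cases hlt : m.natAbs < K
    · rwa [hexact m hm hlt, abs_zero]
    · push Not at hlt
      have h1 : |Q.error (shiftedT m)| ≤ 36 / 35 := by
        rw [Q.error_apply]
        have := abs_sub (unitIntegral (shiftedT m)) (Q.value (shiftedT m))
        have := abs_unitIntegral_shiftedT_le hm (hK.trans hlt)
        have := heven m hm
        linarith
      -- One of the two summands is `ρ ^ |m|`.
      have h2 : ρ ^ K ≤ ρ ^ m + ρ ^ (-m) := by
        have h3 : ρ ^ K ≤ ρ ^ m.natAbs := pow_le_pow_right₀ hρ.le hlt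
        have h4 : 0 < ρ ^ m := zpow_pos h0 m
        have h5 : 0 < ρ ^ (-m) := zpow_pos h0 _
        rw [← zpow_natCast ρ m.natAbs] at h3
        rcases Int.natAbs_eq m with h | h
        · rw [← h] at h3
          linarith
        · rw [show (m.natAbs : ℤ) = -m by omega] at h3
          linarith
      calc |Q.error (shiftedT m)| ≤ 36 / 35 := h1
        _ = 72 / 35 * (ρ ^ K)⁻¹ * (ρ ^ K / 2) := by field_simp; norm_num
        _ ≤ _ := by gcongr
  · rwa [Q.error_apply, unitIntegral_shiftedT_of_odd hm, hodd m hm, sub_zero, abs_zero]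

/-! ### The Clenshaw-Curtis rule -/

theorem card_clenshawCurtis_nodes {n : ℕ} (hn : 1 ≤ n) :
    (clenshawCurtis n).nodes.card = n + 1 := by
  have hn' : (0 : ℝ) < n := by exact_mod_cast hn
  rw [clenshawCurtis, interpolatoryRule, Finset.card_image_of_injOn, Finset.card_range]
  intro i hi j hj hij
  have mem (k : ℕ) (hk : k ∈ (Finset.range (n + 1) : Set ℕ)) :
      (k : ℝ) * Real.pi / n ∈ Set.Icc 0 Real.pi := by
    have : (k : ℝ) ≤ n := by
      have := Finset.mem_range.1 (Finset.mem_coe.1 hk)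
      exact_mod_cast Nat.lt_succ_iff.1 this
    refine ⟨by positivity, ?_⟩
    rw [div_le_iff₀ hn', mul_comm]
    gcongr
  have h := Real.injOn_cos (mem i hi) (mem j hj) (by simp only at hij; linarith)
  have hpi := Real.pi_pos
  field_simp at h
  exact_mod_cast h

/-- On the nodes of the Clenshaw-Curtis rule, `T_m` and `T_{m+2nk}` agree. -/
theorem clenshawCurtis_value_shiftedT_add {n : ℕ} (hn : 1 ≤ n) (m k : ℤ) :
    (clenshawCurtis n).value (shiftedT (m + 2 * n * k)) = (clenshawCurtis n).value (shiftedT m) := by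
  have hn' : (n : ℝ) ≠ 0 := by positivity
  rw [QuadratureRule.value_apply, QuadratureRule.value_apply]
  refine Finset.sum_congr rfl fun x hx => ?_
  congr 1
  obtain ⟨j, -, rfl⟩ := Finset.mem_image.1 hx
  have : 2 * ((1 + Real.cos (j * Real.pi / n)) / 2) - 1 = Real.cos (j * Real.pi / n) := by ring
  rw [eval_shiftedT, eval_shiftedT, this, Chebyshev.T_real_cos, Chebyshev.T_real_cos]
  -- At the node with angle `jπ/n`, raising the degree by `2nk` adds `kj` full turns.
  rw [← Real.cos_add_int_mul_two_pi (m * (j * Real.pi / n)) (k * j)]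
  congr 1
  push_cast
  field_simp

theorem clenshawCurtis_value_shiftedT_of_natAbs_le {n : ℕ} (hn : 1 ≤ n) {m : ℤ}
    (hm : m.natAbs ≤ n) :
    (clenshawCurtis n).value (shiftedT m) = unitIntegral (shiftedT m) := by
  have h : (shiftedT m).degree < (clenshawCurtis n).nodes.card := by
    refine lt_of_le_of_lt degree_le_natDegree ?_
    rw [card_clenshawCurtis_nodes hn, natDegree_shiftedT]
    exact_mod_cast Nat.lt_succ_of_le hm
  exact interpolatoryRule_value_of_degree_lt h

/-- On the shifted Chebyshev polynomials, the Clenshaw-Curtis rule equals the integral of a shifted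
Chebyshev polynomial of degree at most `n` and of the same parity. -/
theorem exists_clenshawCurtis_value_shiftedT {n : ℕ} (hn : 1 ≤ n) (m : ℤ) :
    ∃ m' : ℤ, (Even m ↔ Even m') ∧
      (clenshawCurtis n).value (shiftedT m) = unitIntegral (shiftedT m') := by
  -- The representative of `m` modulo `2n` that lies in `[-n, n)`.
  refine ⟨m - 2 * n * ((m + n) / (2 * n)), ?_, ?_⟩
  · have : Even (2 * n * ((m + n) / (2 * n)) : ℤ) := by
      rw [mul_assoc]; exact even_two_mul _
    grind
  · rw [← clenshawCurtis_value_shiftedT_of_natAbs_le hn,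
      ← clenshawCurtis_value_shiftedT_add hn (m - _) ((m + n) / (2 * n)), sub_add_cancel]
    have h1 := Int.emod_add_mul_ediv (m + n) (2 * n)
    have h2 := Int.emod_nonneg (m + n) (by omega : (2 * n : ℤ) ≠ 0)
    have h3 := Int.emod_lt_of_pos (m + n) (by omega : (0 : ℤ) < 2 * n)
    generalize (2 * n : ℤ) * ((m + n) / (2 * n)) = d at *
    omega

/-- Exactness reaches degree `n`, which allows `K = n + 1`. For even `n` the next degree is odd, so
the first even degree that can fail is `n + 2`. -/
theorem abs_error_clenshawCurtis_shiftedT_le {n K : ℕ} {ρ : ℝ} (hρ : 1 < ρ) (hn : 4 ≤ n)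
    (hK6 : 6 ≤ K) (hK : K ≤ n + 1 ∨ Even n ∧ K ≤ n + 2) (m : ℤ) :
    |(clenshawCurtis n).error (shiftedT m)| ≤
      72 / 35 * (ρ ^ K)⁻¹ * ((ρ ^ m + ρ ^ (-m)) / 2) := by
  refine QuadratureRule.abs_error_shiftedT_le hK6 hρ (fun m hm hmK => ?_) (fun m hm => ?_)
    (fun m hm => ?_) m
  · rw [QuadratureRule.error_apply, clenshawCurtis_value_shiftedT_of_natAbs_le (by omega), sub_self]
    grind
  · obtain ⟨m', hm', h⟩ := exists_clenshawCurtis_value_shiftedT (n := n) (by omega) m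
    rw [h]
    apply unitIntegral_shiftedT_of_odd
    grind
  · obtain ⟨m', hm', h⟩ := exists_clenshawCurtis_value_shiftedT (n := n) (by omega) m
    rw [h]
    exact abs_unitIntegral_shiftedT_le_one m'

/-! ### The Gauss-Legendre rule -/

/-- The shifted Legendre polynomial over `ℝ`. -/
def legendre (N : ℕ) : ℝ[X] := (shiftedLegendre N).map (Int.castRingHom ℝ)

theorem degree_legendre (N : ℕ) : (legendre N).degree = N := by
  rw [legendre, degree_map_eq_of_injective (RingHom.injective_int _), degree_shiftedLegendre]

theorem legendre_ne_zero (N : ℕ) : legendre N ≠ 0 := by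
  intro h
  have := degree_legendre N
  simp [h] at this

theorem factorial_smul_legendre (N : ℕ) :
    (N ! : ℝ) • legendre N = derivative^[N] (X ^ N * (1 - X) ^ N) := by
  have := congrArg (Polynomial.map (Int.castRingHom ℝ)) (factorial_mul_shiftedLegendre_eq N)
  rw [Polynomial.map_mul, ← Polynomial.iterate_derivative_map] at this
  simpa [legendre, smul_eq_C_mul] using this

theorem eval_legendre_one_sub (N : ℕ) (x : ℝ) :
    (legendre N).eval (1 - x) = (-1) ^ N * (legendre N).eval x := by
  have := shiftedLegendre_eval_symm N (1 - x)
  rw [sub_sub_cancel] at this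
  simpa [legendre, aeval_def, eval_map, algebraMap_int_eq] using this

/-- Both endpoints are zeros of order `N`, and each derivative lowers the order by at most one.
These are the boundary terms of the integrations by parts. -/
theorem eval_iterate_derivative_X_pow_mul {N j : ℕ} (hj : j < N) :
    (derivative^[j] (X ^ N * (1 - X) ^ N : ℝ[X])).eval 0 = 0 ∧
    (derivative^[j] (X ^ N * (1 - X) ^ N : ℝ[X])).eval 1 = 0 := by
  have h (q : ℝ[X]) (hq : q ^ N ∣ X ^ N * (1 - X) ^ N) :
      q ∣ derivative^[j] (X ^ N * (1 - X) ^ N) :=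
    (dvd_pow_self q (by omega)).trans (pow_sub_dvd_iterate_derivative_of_pow_dvd j hq)
  constructor
  · exact eval_eq_zero_of_dvd_of_eval_eq_zero (h X (dvd_mul_right _ _)) (by simp)
  · exact eval_eq_zero_of_dvd_of_eval_eq_zero (h (1 - X) (dvd_mul_left _ _)) (by simp)

theorem unitIntegral_iterate_derivative_mul_eq_zero {N : ℕ} :
    ∀ {j : ℕ}, j ≤ N → ∀ q : ℝ[X], q.degree < j →
      unitIntegral (derivative^[j] (X ^ N * (1 - X) ^ N) * q) = 0 := by
  intro j
  induction j with
  | zero =>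
    intro _ q hq
    have : q = 0 := by simpa using hq
    simp [this]
  | succ j ih =>
    intro hj q hq
    have hd : (derivative q).degree < j := by
      rcases eq_or_ne q 0 with rfl | h0
      · simp
      · have h1 := degree_derivative_lt h0
        have h2 : q.degree ≤ j := degree_le_of_natDegree_le
          (Nat.lt_succ_iff.1 ((natDegree_lt_iff_degree_lt h0).2 hq))
        exact h1.trans_le h2
    -- Integration by parts: the boundary values vanish, and the term with `derivative q` falls
    -- under the induction hypothesis.
    have h := unitIntegral_derivative (derivative^[j] (X ^ N * (1 - X) ^ N) * q)
    obtain ⟨h0, h1⟩ := eval_iterate_derivative_X_pow_mul (N := N) (j := j) (by omega)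
    rw [derivative_mul, map_add, ih (by omega) _ hd, eval_mul, eval_mul, h0, h1] at h
    rw [Function.iterate_succ_apply']
    simpa using h

/-- The Legendre polynomial is orthogonal to all polynomials of lower degree. -/
theorem unitIntegral_legendre_mul_eq_zero {N : ℕ} {q : ℝ[X]} (hq : q.degree < N) :
    unitIntegral (legendre N * q) = 0 := by
  have h := unitIntegral_iterate_derivative_mul_eq_zero le_rfl q hq
  rw [← factorial_smul_legendre, smul_mul_assoc, map_smul, smul_eq_mul] at h
  exact (mul_eq_zero.1 h).resolve_left (by positivity)

/-- Rolle's theorem: differentiation yields a new root in each gap between consecutive roots, while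
`0` and `1` stay roots as long as `j < N`. -/
theorem le_card_roots_iterate_derivative {N j : ℕ} (hj : j < N) :
    j + 2 ≤ (derivative^[j] (X ^ N * (1 - X) ^ N : ℝ[X])).roots.toFinset.card ∧
      derivative^[j] (X ^ N * (1 - X) ^ N : ℝ[X]) ≠ 0 := by
  have hne {j : ℕ} (hj : j ≤ N) : derivative^[j] (X ^ N * (1 - X) ^ N : ℝ[X]) ≠ 0 := by
    intro h
    have h' : derivative^[N] (X ^ N * (1 - X) ^ N : ℝ[X]) = 0 := by
      rw [← Nat.sub_add_cancel hj, Function.iterate_add_apply, Nat.sub_add_cancel hj, h,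
        iterate_derivative_zero]
    rw [← factorial_smul_legendre] at h'
    exact (smul_ne_zero (by positivity) (legendre_ne_zero N)) h'
  have hsub {j : ℕ} (hj : j < N) :
      ({0, 1} : Finset ℝ) ⊆ (derivative^[j] (X ^ N * (1 - X) ^ N : ℝ[X])).roots.toFinset := by
    obtain ⟨h0, h1⟩ := eval_iterate_derivative_X_pow_mul hj
    intro x hx
    rw [Multiset.mem_toFinset, mem_roots (hne hj.le)]
    rcases Finset.mem_insert.1 hx with rfl | hx
    · exact h0
    · rw [Finset.mem_singleton.1 hx]
      exact h1
  refine ⟨?_, hne hj.le⟩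
  induction j with
  | zero => simpa using Finset.card_le_card (hsub hj)
  | succ j ih =>
    have h1 := ih (by omega)
    -- The Rolle roots counted here are not roots of the `j`-th derivative, so they differ from `0`
    -- and `1`, which can be counted on top.
    have h2 := card_roots_toFinset_le_card_roots_derivative_sdiff_roots_succ
      (derivative^[j] (X ^ N * (1 - X) ^ N : ℝ[X]))
    rw [← Function.iterate_succ_apply' derivative] at h2
    have h3 := Finset.card_le_card (Finset.union_subset
      (Finset.sdiff_subset (s := (derivative^[j + 1] (X ^ N * (1 - X) ^ N : ℝ[X])).roots.toFinset)
        (t := (derivative^[j] (X ^ N * (1 - X) ^ N : ℝ[X])).roots.toFinset)) (hsub hj))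
    rw [Finset.card_union_of_disjoint
      (Finset.sdiff_disjoint.mono_right (hsub (by omega : j < N)))] at h3
    have h4 : ({0, 1} : Finset ℝ).card = 2 := by simp
    simp only [Nat.succ_eq_add_one] at h2
    omega

theorem card_roots_legendre (n : ℕ) : (legendre (n + 1)).roots.toFinset.card = n + 1 := by
  refine le_antisymm ?_ ?_
  · refine (Multiset.toFinset_card_le _).trans ((card_roots' _).trans ?_)
    exact (natDegree_eq_of_degree_eq_some (degree_legendre (n + 1))).le
  · have h1 := (le_card_roots_iterate_derivative (Nat.lt_add_one n)).1
    have h2 := card_roots_toFinset_le_derivative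
      (derivative^[n] (X ^ (n + 1) * (1 - X) ^ (n + 1) : ℝ[X]))
    rw [← Function.iterate_succ_apply' derivative, ← factorial_smul_legendre,
      roots_smul_nonzero _ (by positivity), Nat.succ_eq_add_one] at h2
    omega

theorem gaussLegendre_eq (n : ℕ) :
    gaussLegendre n = interpolatoryRule (legendre (n + 1)).roots.toFinset := rfl

theorem card_gaussLegendre_nodes (n : ℕ) : (gaussLegendre n).nodes.card = n + 1 :=
  card_roots_legendre n

theorem mem_gaussLegendre_nodes {n : ℕ} {x : ℝ} :
    x ∈ (gaussLegendre n).nodes ↔ (legendre (n + 1)).eval x = 0 := by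
  rw [gaussLegendre_eq, interpolatoryRule, Multiset.mem_toFinset, mem_roots (legendre_ne_zero _)]
  rfl

/-- Gauss quadrature with `n + 1` nodes is exact up to degree `2n + 1`. -/
theorem gaussLegendre_value_of_degree_lt {n : ℕ} {q : ℝ[X]} (hq : q.degree < (2 * n + 2 : ℕ)) :
    (gaussLegendre n).value q = unitIntegral q := by
  have hP := legendre_ne_zero (n + 1)
  have hr : (q % legendre (n + 1)).degree < (n + 1 : ℕ) := by
    have := degree_mod_lt q hP
    rwa [degree_legendre] at this
  have hd : (q / legendre (n + 1)).degree < (n + 1 : ℕ) := by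
    by_cases h : (legendre (n + 1)).degree ≤ q.degree
    · have h1 := degree_add_div hP h
      rw [degree_legendre] at h1
      rw [← h1, show 2 * n + 2 = (n + 1) + (n + 1) by ring] at hq
      push_cast at hq ⊢
      exact lt_of_add_lt_add_left hq
    · rw [(Polynomial.div_eq_zero_iff hP).2 (not_le.1 h)]
      simp
  -- Divide by the Legendre polynomial: the quotient part has integral zero by orthogonality and
  -- vanishes at the nodes, and the interpolatory rule is exact on the remainder.
  conv_rhs => rw [← EuclideanDomain.div_add_mod q (legendre (n + 1)), map_add,
    unitIntegral_legendre_mul_eq_zero hd, zero_add]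
  rw [← interpolatoryRule_value_of_degree_lt (s := (legendre (n + 1)).roots.toFinset)
    (by rwa [card_roots_legendre]), ← gaussLegendre_eq, QuadratureRule.value_apply,
    QuadratureRule.value_apply]
  refine Finset.sum_congr rfl fun x hx => ?_
  conv_lhs => rw [← EuclideanDomain.div_add_mod q (legendre (n + 1))]
  rw [eval_add, eval_mul, mem_gaussLegendre_nodes.1 hx, zero_mul, zero_add]

/-- The rule is exact on `r l²` for `r` of degree at most one and `l` the Lagrange basis polynomial
at `x`, since the degree is at most `2n + 1`. Taking `r = 1`, `X`, `1 - X`, all nonnegative on `[0,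
1]`, gives the three inequalities. They place `x` in `[0, 1]` whenever its weight is nonzero. -/
theorem gaussLegendre_weight_nonneg_and_mem {n : ℕ} {x : ℝ} (hx : x ∈ (gaussLegendre n).nodes) :
    0 ≤ (gaussLegendre n).weight x ∧
      0 ≤ (gaussLegendre n).weight x * x ∧
      (gaussLegendre n).weight x * x ≤ (gaussLegendre n).weight x := by
  set s := (gaussLegendre n).nodes with hs
  have hinj : Set.InjOn (id : ℝ → ℝ) s := Function.injective_id.injOn
  set l := Lagrange.basis s id x with hl
  have hdeg : l.degree = (n : ℕ) := by
    rw [Lagrange.degree_basis hinj hx, hs, card_gaussLegendre_nodes, Nat.add_sub_cancel]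
  have hval (r : ℝ[X]) (hr : r.degree ≤ 1) :
      unitIntegral (r * l ^ 2) = (gaussLegendre n).weight x * r.eval x := by
    rw [← gaussLegendre_value_of_degree_lt (n := n), QuadratureRule.value_apply, Finset.sum_eq_single x]
    · have : l.eval x = 1 := Lagrange.eval_basis_self (v := id) hinj hx
      simp [this]
    · intro y hy hyx
      have : l.eval y = 0 := Lagrange.eval_basis_of_ne (v := id) hyx.symm hy
      simp [this]
    · exact fun h => absurd hx h
    · rw [degree_mul, degree_pow, hdeg]
      refine lt_of_le_of_lt (add_le_add_left hr _) ?_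
      rw [nsmul_eq_mul]
      norm_cast
      omega
  have h1 := hval 1 (degree_one_le.trans zero_le_one)
  have h2 := hval X degree_X_le
  have h3 := hval (1 - X) ((degree_sub_le _ _).trans (max_le (degree_one_le.trans zero_le_one)
    degree_X_le))
  simp only [eval_one, eval_X, eval_sub, mul_one] at h1 h2 h3
  have p1 : 0 ≤ unitIntegral (1 * l ^ 2) := unitIntegral_nonneg fun t _ => by
    simp only [eval_mul, eval_one, eval_pow]; positivity
  have p2 : 0 ≤ unitIntegral (X * l ^ 2) := unitIntegral_nonneg fun t ht => by
    simp only [eval_mul, eval_X, eval_pow]; exact mul_nonneg ht.1 (sq_nonneg _)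
  have p3 : 0 ≤ unitIntegral ((1 - X) * l ^ 2) := unitIntegral_nonneg fun t ht => by
    simp only [eval_mul, eval_sub, eval_one, eval_X, eval_pow]
    exact mul_nonneg (sub_nonneg.2 ht.2) (sq_nonneg _)
  exact ⟨h1 ▸ p1, h2 ▸ p2, by linarith⟩

theorem abs_gaussLegendre_value_shiftedT_le_one (n : ℕ) (m : ℤ) :
    |(gaussLegendre n).value (shiftedT m)| ≤ 1 := by
  have hsum : ∑ x ∈ (gaussLegendre n).nodes, (gaussLegendre n).weight x = 1 := by
    have := gaussLegendre_value_of_degree_lt (n := n) (q := 1)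
      (lt_of_le_of_lt degree_one_le (by norm_cast; omega))
    rw [QuadratureRule.value_apply, ← C_1, unitIntegral_C] at this
    simpa using this
  rw [QuadratureRule.value_apply, ← hsum]
  refine (Finset.abs_sum_le_sum_abs _ _).trans (Finset.sum_le_sum fun x hx => ?_)
  obtain ⟨h0, h1, h2⟩ := gaussLegendre_weight_nonneg_and_mem hx
  rw [abs_mul, abs_of_nonneg h0]
  -- A node of weight zero contributes nothing, so its location is irrelevant.
  rcases h0.eq_or_lt with h | h
  · simp [← h]
  · refine mul_le_of_le_one_right h0 (abs_eval_shiftedT_le_one m ⟨?_, ?_⟩)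
    · exact nonneg_of_mul_nonneg_right h1 h
    · exact (mul_le_iff_le_one_right h).1 h2

theorem gaussLegendre_value_shiftedT_of_odd (n : ℕ) {m : ℤ} (hm : Odd m) :
    (gaussLegendre n).value (shiftedT m) = 0 := by
  have h := interpolatoryRule_value_comp_one_sub_X (s := (gaussLegendre n).nodes)
    (fun x hx => by
      rw [mem_gaussLegendre_nodes] at hx ⊢
      rw [eval_legendre_one_sub, hx, mul_zero]) (shiftedT m)
  rw [shiftedT_comp_one_sub_X hm, map_neg] at h
  change -(gaussLegendre n).value _ = (gaussLegendre n).value _ at h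
  linarith

theorem abs_error_gaussLegendre_shiftedT_le {n : ℕ} {ρ : ℝ} (hρ : 1 < ρ) (hn : 2 ≤ n) (m : ℤ) :
    |(gaussLegendre n).error (shiftedT m)| ≤
      72 / 35 * (ρ ^ (2 * n + 2))⁻¹ * ((ρ ^ m + ρ ^ (-m)) / 2) := by
  refine QuadratureRule.abs_error_shiftedT_le (by omega) hρ (fun m _ hm => ?_)
    (fun m hm => gaussLegendre_value_shiftedT_of_odd n hm)
    (fun m _ => abs_gaussLegendre_value_shiftedT_le_one n m) m
  rw [QuadratureRule.error_apply, gaussLegendre_value_of_degree_lt, sub_self]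
  refine lt_of_le_of_lt degree_le_natDegree ?_
  rw [natDegree_shiftedT]
  exact_mod_cast hm

/-! ### The error of the algorithm as a series -/

theorem hasSum_of_forall_eq {α β : Type*} [AddCommMonoid α] [TopologicalSpace α] {f f' : β → α}
    {a : α} (h : HasSum f a) (hf : ∀ k, f' k = f k) : HasSum f' a :=
  (funext hf : f' = f) ▸ h

section Series

variable {𝕜 : Type*} [RCLike 𝕜] {ι : Type*} [Fintype ι]

/-- `M ↦ M b` as a continuous linear map. -/
def mulVecCLM (b : ι → 𝕜) : Matrix ι ι 𝕜 →L[ℝ] (ι → 𝕜) :=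
  LinearMap.mkContinuous
    { toFun := fun N => N.mulVec b
      map_add' := fun N N' => Matrix.add_mulVec N N' b
      map_smul' := fun c N => Matrix.smul_mulVec c N b } ‖b‖
    fun N => (Matrix.linfty_opNorm_mulVec N b).trans_eq (mul_comm _ _)

theorem mulVecCLM_apply (b : ι → 𝕜) (N : Matrix ι ι 𝕜) : mulVecCLM b N = N.mulVec b := rfl

variable [DecidableEq ι]

theorem norm_pow_mulVec_le (A : Matrix ι ι 𝕜) (b : ι → 𝕜) (k : ℕ) :
    ‖(A ^ k).mulVec b‖ ≤ ‖A‖ ^ k * ‖b‖ := by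
  induction k with
  | zero => simp
  | succ k ih =>
    rw [pow_succ', ← Matrix.mulVec_mulVec, pow_succ', mul_assoc]
    exact (Matrix.linfty_opNorm_mulVec _ _).trans (by gcongr)

theorem hasSum_expAction (A : Matrix ι ι 𝕜) (b : ι → 𝕜) (x : ℝ) :
    HasSum (fun k : ℕ => ((1 - x) ^ k / (k ! : ℝ)) • (A ^ k).mulVec b) (expAction A b x) := by
  have h := (NormedSpace.exp_series_hasSum_exp' (𝕂 := ℝ) ((1 - x) • A)).mapL (mulVecCLM b)
  refine hasSum_of_forall_eq h fun k => ?_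
  rw [map_smul, mulVecCLM_apply, _root_.smul_pow, Matrix.smul_mulVec, smul_smul, div_eq_inv_mul]

theorem phi_succ_mulVec (p : ℕ) (A : Matrix ι ι 𝕜) (b : ι → 𝕜) :
    (phi (p + 1) A).mulVec b =
      ∫ θ in (0 : ℝ)..1, (θ ^ p / (p ! : ℝ)) • expAction A b θ := by
  have hc : Continuous fun θ : ℝ =>
      (θ ^ p / (p ! : ℝ)) • NormedSpace.exp ((1 - θ) • A) :=
    Continuous.smul ((continuous_pow p).div_const _)
      (NormedSpace.exp_continuous.comp ((continuous_const.sub continuous_id).smul continuous_const))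
  refine ((mulVecCLM b).intervalIntegral_comp_comm (hc.intervalIntegrable 0 1)).symm.trans ?_
  exact intervalIntegral.integral_congr fun θ _ => (mulVecCLM b).map_smul _ _

/-- Termwise integration of the exponential series, dominated on `[0, 1]` by the series of `e^‖A‖
‖b‖`. -/
theorem hasSum_phi_succ_mulVec (p : ℕ) (A : Matrix ι ι 𝕜) (b : ι → 𝕜) :
    HasSum (fun k : ℕ => (unitIntegral (X ^ p * (1 - X) ^ k) / (p ! * k ! : ℝ)) • (A ^ k).mulVec b)
      ((phi (p + 1) A).mulVec b) := by
  have h := intervalIntegral.hasSum_integral_of_dominated_convergence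
    (μ := MeasureTheory.volume) (a := (0 : ℝ)) (b := 1)
    (F := fun (k : ℕ) (θ : ℝ) =>
      (θ ^ p * (1 - θ) ^ k / (p ! * k ! : ℝ)) • (A ^ k).mulVec b)
    (f := fun θ => (θ ^ p / (p ! : ℝ)) • expAction A b θ)
    (fun k _ => ‖A‖ ^ k / k ! * ‖b‖) (fun k => ?_) (fun k => ?_) ?_ ?_ ?_
  · rw [phi_succ_mulVec]
    refine hasSum_of_forall_eq h fun k => ?_
    rw [intervalIntegral.integral_smul_const, intervalIntegral.integral_div, unitIntegral_apply]
    simp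
  · exact Continuous.aestronglyMeasurable (by fun_prop)
  · refine Filter.Eventually.of_forall fun θ hθ => ?_
    rw [Set.uIoc_of_le zero_le_one] at hθ
    have h0 : 0 ≤ θ := hθ.1.le
    have h1 : 0 ≤ 1 - θ := sub_nonneg.2 hθ.2
    rw [norm_smul, Real.norm_of_nonneg (by positivity), div_mul_eq_mul_div, div_mul_eq_mul_div]
    have hp : (1 : ℝ) ≤ p ! := by exact_mod_cast Nat.factorial_pos p
    have e1 : θ ^ p ≤ 1 := pow_le_one₀ h0 hθ.2
    have e2 : (1 - θ) ^ k ≤ 1 := pow_le_one₀ h1 (by linarith)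
    have e3 : θ ^ p * (1 - θ) ^ k ≤ 1 := mul_le_one₀ e1 (by positivity) e2
    have e4 := norm_pow_mulVec_le A b k
    refine div_le_div₀ (by positivity) ?_ (by positivity) (le_mul_of_one_le_left (by positivity) hp)
    exact (mul_le_of_le_one_left (by positivity) e3).trans e4
  · exact Filter.Eventually.of_forall fun θ _ => (Real.summable_pow_div_factorial ‖A‖).mul_right _
  · exact intervalIntegrable_const
  · refine Filter.Eventually.of_forall fun θ _ => ?_
    refine hasSum_of_forall_eq ((hasSum_expAction A b θ).const_smul (θ ^ p / (p ! : ℝ)))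
      fun k => ?_
    rw [smul_smul, div_mul_div_comm]

theorem hasSum_algorithmOne (Q : QuadratureRule) (p : ℕ) (A : Matrix ι ι 𝕜) (b : ι → 𝕜) :
    HasSum (fun k : ℕ => (Q.value (X ^ p * (1 - X) ^ k) / (p ! * k ! : ℝ)) • (A ^ k).mulVec b)
      (algorithmOne Q (expAction A b) (p + 1)) := by
  have h := hasSum_sum (s := Q.nodes) fun x _ =>
    (hasSum_expAction A b x).const_smul (Q.weight x * (x ^ p / (p ! : ℝ)))
  refine hasSum_of_forall_eq h fun k => ?_
  simp_rw [smul_smul, ← Finset.sum_smul, QuadratureRule.value_apply, Finset.sum_div]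
  congr 1
  refine Finset.sum_congr rfl fun x _ => ?_
  simp only [eval_mul, eval_pow, eval_sub, eval_one, eval_X]
  field_simp

/-- If the error functional of a rule is bounded by `B (ρ^m + ρ^{-m})/2` on the shifted Chebyshev
polynomials, then the error of the algorithm is at most `2 B M(ρ)`. -/
theorem norm_phi_sub_algorithmOne_le {Q : QuadratureRule} {ρ B : ℝ} (hρ : 0 < ρ)
    (hQ : ∀ m : ℤ, |Q.error (shiftedT m)| ≤ B * ((ρ ^ m + ρ ^ (-m)) / 2))
    (p : ℕ) (A : Matrix ι ι 𝕜) (b : ι → 𝕜) :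
    ‖(phi (p + 1) A).mulVec b - algorithmOne Q (expAction A b) (p + 1)‖ ≤
      2 * B * M p ‖A‖ ‖b‖ ρ := by
  have hs := (hasSum_phi_succ_mulVec p A b).sub (hasSum_algorithmOne Q p A b)
  have hexp : HasSum (fun k : ℕ => (g ρ / 2 * ‖A‖) ^ k / k !) (Real.exp (g ρ / 2 * ‖A‖)) := by
    rw [Real.exp_eq_exp_ℝ]
    exact NormedSpace.expSeries_div_hasSum_exp _
  have hb := hexp.mul_left (B * (g ρ / 2) ^ p / p ! * ‖b‖)
  have e : 2 * B * M p ‖A‖ ‖b‖ ρ =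
      B * (g ρ / 2) ^ p / p ! * ‖b‖ * Real.exp (g ρ / 2 * ‖A‖) := by
    rw [M, show 1 / 2 * g ρ * ‖A‖ = g ρ / 2 * ‖A‖ by ring, div_pow]
    field_simp
    ring
  rw [e]
  refine hs.norm_le_of_bounded hb fun k => ?_
  rw [← sub_smul, ← sub_div, ← QuadratureRule.error_apply, norm_smul, norm_div, Real.norm_eq_abs,
    Real.norm_of_nonneg (by positivity : (0 : ℝ) ≤ p ! * k !)]
  have h1 := abs_apply_X_pow_mul_one_sub_X_pow_le hρ p k Q.error B hQ
  have h2 := norm_pow_mulVec_le A b k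
  calc |Q.error (X ^ p * (1 - X) ^ k)| / (p ! * k !) * ‖(A ^ k).mulVec b‖
      ≤ B * (g ρ / 2) ^ (p + k) / (p ! * k !) * (‖A‖ ^ k * ‖b‖) := by
        have := (abs_nonneg _).trans h1
        gcongr
    _ = _ := by
      rw [pow_add, mul_pow]
      field_simp

theorem M_nonneg (p : ℕ) {α β ρ : ℝ} (hβ : 0 ≤ β) (hρ : 0 < ρ) : 0 ≤ M p α β ρ := by
  have : 0 ≤ g ρ := by unfold g; positivity
  unfold M
  positivity

theorem norm_phi_sub_algorithmOne_le_div {Q : QuadratureRule} {ρ : ℝ} {K : ℕ} (hρ : 1 < ρ)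
    (hQ : ∀ m : ℤ, |Q.error (shiftedT m)| ≤ 72 / 35 * (ρ ^ K)⁻¹ * ((ρ ^ m + ρ ^ (-m)) / 2))
    (p : ℕ) (A : Matrix ι ι 𝕜) (b : ι → 𝕜) {e : ℤ} (he : e = 2 - K) :
    ‖(phi (p + 1) A).mulVec b - algorithmOne Q (expAction A b) (p + 1)‖ ≤
      144 / 35 * (M p ‖A‖ ‖b‖ ρ * ρ ^ e / (ρ ^ 2 - 1)) := by
  have h0 : 0 < ρ := by linarith
  have hM := M_nonneg p (α := ‖A‖) (norm_nonneg b) h0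
  have h2 : 0 < ρ ^ 2 - 1 := by nlinarith
  refine (norm_phi_sub_algorithmOne_le h0 hQ p A b).trans ?_
  rw [he, zpow_sub₀ h0.ne', zpow_natCast, show ρ ^ (2 : ℤ) = ρ ^ 2 by norm_cast]
  -- The bound with `ρ^{-K}` is already sharper; this factor only brings it to the stated form with
  -- `ρ^{2-K}/(ρ² - 1)`.
  have h1 : 1 ≤ ρ ^ 2 / (ρ ^ 2 - 1) := by rw [one_le_div h2]; linarith
  calc 2 * (72 / 35 * (ρ ^ K)⁻¹) * M p ‖A‖ ‖b‖ ρ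
      = 144 / 35 * (M p ‖A‖ ‖b‖ ρ * (ρ ^ K)⁻¹) * 1 := by ring
    _ ≤ 144 / 35 * (M p ‖A‖ ‖b‖ ρ * (ρ ^ K)⁻¹) * (ρ ^ 2 / (ρ ^ 2 - 1)) := by gcongr
    _ = _ := by ring

end Series

/-! ### The quartics -/

/-- Intermediate value theorem: the hypothesis says that the quartic is negative at `1`. For both
rules the three coefficients sum to `-2 - 8α⁻¹`. -/
theorem exists_one_lt_isRoot_quartic {a₃ a₂ a₁ : ℝ} (h : a₃ + a₂ + a₁ < -2) :
    ∃ ρ : ℝ, 1 < ρ ∧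
      (X ^ 4 + C a₃ * X ^ 3 + C a₂ * X ^ 2 + C a₁ * X + 1 : ℝ[X]).IsRoot ρ := by
  set q : ℝ[X] := X ^ 4 + C a₃ * X ^ 3 + C a₂ * X ^ 2 + C a₁ * X + 1 with hq
  have hev (x : ℝ) : q.eval x = x ^ 4 + a₃ * x ^ 3 + a₂ * x ^ 2 + a₁ * x + 1 := by simp [hq]
  -- Chosen so that `R ^ 4 = R * R ^ 3` dominates all lower terms.
  set R : ℝ := 1 + |a₃| + |a₂| + |a₁| with hR
  have h1 : 1 ≤ R := by
    have := abs_nonneg a₃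
    have := abs_nonneg a₂
    have := abs_nonneg a₁
    linarith
  have hneg : q.eval 1 < 0 := by rw [hev]; linarith
  have hpos : 0 ≤ q.eval R := by
    have e3 : -(|a₃| * R ^ 3) ≤ a₃ * R ^ 3 := by
      rw [← neg_mul]; gcongr; exact neg_abs_le _
    have e2 : -(|a₂| * R ^ 3) ≤ a₂ * R ^ 2 := by
      have : |a₂| * R ^ 2 ≤ |a₂| * R ^ 3 := by gcongr; norm_num
      have : -|a₂| * R ^ 2 ≤ a₂ * R ^ 2 := by gcongr; exact neg_abs_le _
      linarith
    have e1 : -(|a₁| * R ^ 3) ≤ a₁ * R := by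
      have : |a₁| * R ≤ |a₁| * R ^ 3 := by gcongr; exact le_self_pow₀ h1 (by norm_num)
      have : -|a₁| * R ≤ a₁ * R := by gcongr; exact neg_abs_le _
      linarith
    have e4 : R ^ 4 = R ^ 3 + |a₃| * R ^ 3 + |a₂| * R ^ 3 + |a₁| * R ^ 3 := by
      rw [pow_succ, hR]; ring
    have : 0 ≤ R ^ 3 := by positivity
    rw [hev]
    linarith
  obtain ⟨ρ, hρ, h0⟩ := intermediate_value_Icc h1 q.continuousOn ⟨hneg.le, hpos⟩
  refine ⟨ρ, lt_of_le_of_ne hρ.1 ?_, h0⟩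
  rintro rfl
  linarith

theorem exists_one_lt_isRoot_ccQuartic (p n : ℕ) {α : ℝ} (hα : 0 < α) :
    ∃ ρ : ℝ, 1 < ρ ∧ (ccQuartic p n α).IsRoot ρ := by
  have := inv_pos.2 hα
  exact exists_one_lt_isRoot_quartic (by linarith)

theorem exists_one_lt_isRoot_gaussQuartic (p n : ℕ) {α : ℝ} (hα : 0 < α) :
    ∃ ρ : ℝ, 1 < ρ ∧ (gaussQuartic p n α).IsRoot ρ := by
  have := inv_pos.2 hα
  exact exists_one_lt_isRoot_quartic (by linarith)

/-! ### The error bounds for a matrix without assumed structure -/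

section Bounds

variable {𝕜 : Type*} [RCLike 𝕜] {ι : Type*} [Fintype ι] [DecidableEq ι]

theorem norm_phi_sub_clenshawCurtis_le_of_even {n : ℕ} (hn : 4 ≤ n) (he : Even n) (p : ℕ)
    (A : Matrix ι ι 𝕜) (b : ι → 𝕜) {ρ : ℝ} (hρ : 1 < ρ) :
    ‖(phi (p + 1) A).mulVec b - algorithmOne (clenshawCurtis n) (expAction A b) (p + 1)‖ ≤
      ccBound p (n + 1) ‖A‖ ‖b‖ ρ :=
  norm_phi_sub_algorithmOne_le_div (K := n + 2) hρ
    (abs_error_clenshawCurtis_shiftedT_le hρ hn (by omega) (Or.inr ⟨he, le_rfl⟩)) p A b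
    (by push_cast; ring)

theorem norm_phi_sub_clenshawCurtis_le {n : ℕ} (hn : 4 ≤ n) (p : ℕ)
    (A : Matrix ι ι 𝕜) (b : ι → 𝕜) {ρ : ℝ} (hρ : 1 < ρ) :
    ‖(phi (p + 1) A).mulVec b - algorithmOne (clenshawCurtis n) (expAction A b) (p + 1)‖ ≤
      ccBound p n ‖A‖ ‖b‖ ρ := by
  rcases Nat.even_or_odd n with he | ho
  -- For `n = 4` the choice `K = n + 1` would violate `6 ≤ K`, so even `n` goes through the sharper
  -- bound.
  · refine (norm_phi_sub_clenshawCurtis_le_of_even hn he p A b hρ).trans ?_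
    have hM := M_nonneg p (α := ‖A‖) (norm_nonneg b) (by linarith : 0 < ρ)
    have h2 : 0 < ρ ^ 2 - 1 := by nlinarith
    unfold ccBound
    gcongr
    · exact hρ.le
    · omega
  · exact norm_phi_sub_algorithmOne_le_div (K := n + 1) hρ
      (abs_error_clenshawCurtis_shiftedT_le hρ hn (by grind) (Or.inl le_rfl)) p A b
      (by push_cast; ring)

theorem norm_phi_sub_gaussLegendre_le {n : ℕ} (hn : 2 ≤ n) (p : ℕ)
    (A : Matrix ι ι 𝕜) (b : ι → 𝕜) {ρ : ℝ} (hρ : 1 < ρ) :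
    ‖(phi (p + 1) A).mulVec b - algorithmOne (gaussLegendre n) (expAction A b) (p + 1)‖ ≤
      gaussBound p n ‖A‖ ‖b‖ ρ :=
  norm_phi_sub_algorithmOne_le_div (K := 2 * n + 2) hρ
    (abs_error_gaussLegendre_shiftedT_le hρ hn) p A b (by push_cast; ring)

theorem errorBounds_expAction (p n : ℕ) {A : Matrix ι ι 𝕜} (hA : A ≠ 0) (b : ι → 𝕜) :
    ErrorBounds p n A b (expAction A b) := by
  have hα : 0 < ‖A‖ := norm_pos_iff.2 hA
  refine ⟨fun hn => ⟨card_clenshawCurtis_nodes (by omega),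
    exists_one_lt_isRoot_ccQuartic p n hα,
    fun ρ hρ _ => norm_phi_sub_clenshawCurtis_le hn p A b hρ,
    fun he => ⟨exists_one_lt_isRoot_ccQuartic p (n + 1) hα,
      fun ρ hρ _ => norm_phi_sub_clenshawCurtis_le_of_even hn he p A b hρ⟩⟩,
    fun hn => ⟨card_gaussLegendre_nodes n, exists_one_lt_isRoot_gaussQuartic p n hα,
      fun ρ hρ _ => norm_phi_sub_gaussLegendre_le hn p A b hρ⟩⟩

end Bounds

/-! ### Kronecker sums -/

section Kronecker

variable {𝕜 : Type*} [RCLike 𝕜] {ιx ιy ιz : Type*}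

section

variable [DecidableEq ιx] [DecidableEq ιy] [DecidableEq ιz]

theorem smul_kronSum₂ (c : ℝ) (Ax : Matrix ιx ιx 𝕜) (Ay : Matrix ιy ιy 𝕜) :
    c • kronSum₂ Ax Ay = kronSum₂ (c • Ax) (c • Ay) := by
  rw [kronSum₂, kronSum₂, smul_add, Matrix.smul_kronecker, Matrix.kronecker_smul]

theorem kronSum₃_eq (Ax : Matrix ιx ιx 𝕜) (Ay : Matrix ιy ιy 𝕜) (Az : Matrix ιz ιz 𝕜) :
    kronSum₃ Ax Ay Az = kronSum₂ (kronSum₂ Ax Ay) Az := by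
  rw [kronSum₃, kronSum₂, kronSum₂, Matrix.add_kronecker, Matrix.one_kronecker_one]

end

variable [Fintype ιx] [Fintype ιy] [Fintype ιz]

theorem kronecker_kronecker_mulVec_vec₃ (Nx : Matrix ιx ιx 𝕜) (Ny : Matrix ιy ιy 𝕜)
    (Nz : Matrix ιz ιz 𝕜) (B : ιx → ιy → ιz → 𝕜) :
    (Nx ⊗ₖ Ny ⊗ₖ Nz).mulVec (vec₃ B) =
      vec₃ (modeProd₃ (modeProd₂ (modeProd₁ B Nx) Ny) Nz) := by
  funext ⟨⟨i, j⟩, k⟩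
  simp only [Matrix.mulVec, dotProduct, vec₃, modeProd₁, modeProd₂, modeProd₃,
    Fintype.sum_prod_type, Matrix.kroneckerMap_apply, Finset.mul_sum]
  rw [Finset.sum_comm_cycle]
  refine Finset.sum_congr rfl fun z _ => ?_
  rw [Finset.sum_comm]
  refine Finset.sum_congr rfl fun y _ => Finset.sum_congr rfl fun x _ => ?_
  ring

variable [DecidableEq ιx] [DecidableEq ιy] [DecidableEq ιz]

/-- Tensoring with the identity is a continuous ring homomorphism, and these commute with the
exponential. -/
theorem exp_kronecker_one (A : Matrix ιx ιx 𝕜) :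
    NormedSpace.exp (A ⊗ₖ (1 : Matrix ιy ιy 𝕜)) = NormedSpace.exp A ⊗ₖ (1 : Matrix ιy ιy 𝕜) := by
  let f : Matrix ιx ιx 𝕜 →+* Matrix (ιx × ιy) (ιx × ιy) 𝕜 :=
    { toFun := fun N => N ⊗ₖ (1 : Matrix ιy ιy 𝕜)
      map_one' := Matrix.one_kronecker_one
      map_mul' := fun N N' => by rw [← Matrix.mul_kronecker_mul, one_mul]
      map_zero' := Matrix.zero_kronecker _
      map_add' := fun N N' => Matrix.add_kronecker _ _ _ }
  have hf : Continuous f :=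
    continuous_matrix fun i j => (continuous_id.matrix_elem i.1 j.1).mul continuous_const
  exact (NormedSpace.map_exp f hf A).symm

theorem exp_one_kronecker (A : Matrix ιy ιy 𝕜) :
    NormedSpace.exp ((1 : Matrix ιx ιx 𝕜) ⊗ₖ A) = (1 : Matrix ιx ιx 𝕜) ⊗ₖ NormedSpace.exp A := by
  let f : Matrix ιy ιy 𝕜 →+* Matrix (ιx × ιy) (ιx × ιy) 𝕜 :=
    { toFun := fun N => (1 : Matrix ιx ιx 𝕜) ⊗ₖ N
      map_one' := Matrix.one_kronecker_one
      map_mul' := fun N N' => by rw [← Matrix.mul_kronecker_mul, one_mul]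
      map_zero' := Matrix.kronecker_zero _
      map_add' := fun N N' => Matrix.kronecker_add _ _ _ }
  have hf : Continuous f :=
    continuous_matrix fun i j => continuous_const.mul (continuous_id.matrix_elem i.2 j.2)
  exact (NormedSpace.map_exp f hf A).symm

theorem exp_kronSum₂ (Ax : Matrix ιx ιx 𝕜) (Ay : Matrix ιy ιy 𝕜) :
    NormedSpace.exp (kronSum₂ Ax Ay) = NormedSpace.exp Ax ⊗ₖ NormedSpace.exp Ay := by
  rw [kronSum₂, Matrix.exp_add_of_commute, exp_kronecker_one, exp_one_kronecker,
    ← Matrix.mul_kronecker_mul, mul_one, one_mul]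
  -- The two summands commute: both products are `Ax ⊗ₖ Ay`.
  rw [Commute, SemiconjBy, ← Matrix.mul_kronecker_mul, ← Matrix.mul_kronecker_mul]
  simp

theorem expAction_kronSum₂ (Ax : Matrix ιx ιx 𝕜) (Ay : Matrix ιy ιy 𝕜) (B : Matrix ιy ιx 𝕜) :
    expAction (kronSum₂ Ax Ay) B.vec = kronExpAction₂ Ax Ay B := by
  funext x
  rw [expAction, kronExpAction₂, smul_kronSum₂, exp_kronSum₂, Matrix.kronecker_mulVec_vec]

theorem expAction_kronSum₃ (Ax : Matrix ιx ιx 𝕜) (Ay : Matrix ιy ιy 𝕜) (Az : Matrix ιz ιz 𝕜)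
    (B : ιx → ιy → ιz → 𝕜) :
    expAction (kronSum₃ Ax Ay Az) (vec₃ B) = kronExpAction₃ Ax Ay Az B := by
  funext x
  rw [expAction, kronExpAction₃, kronSum₃_eq, smul_kronSum₂, exp_kronSum₂, smul_kronSum₂,
    exp_kronSum₂, kronecker_kronecker_mulVec_vec₃]

end Kronecker

end PhiQuad

end

theorem theorem3p2 {𝕜 : Type*} [RCLike 𝕜] {ι ιx ιy ιz : Type*}
    [Fintype ι] [DecidableEq ι] [Fintype ιx] [DecidableEq ιx]
    [Fintype ιy] [DecidableEq ιy] [Fintype ιz] [DecidableEq ιz] (p n : ℕ) :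
    -- an arbitrary nonzero square matrix
    (∀ (A : Matrix ι ι 𝕜) (b : ι → 𝕜), A ≠ 0 →
      PhiQuad.ErrorBounds p n A b (PhiQuad.expAction A b)) ∧
    -- Kronecker sums in 2D, with one-dimensional exponentials only
    (∀ (Ax : Matrix ιx ιx 𝕜) (Ay : Matrix ιy ιy 𝕜) (B : Matrix ιy ιx 𝕜),
      PhiQuad.kronSum₂ Ax Ay ≠ 0 →
      PhiQuad.ErrorBounds p n (PhiQuad.kronSum₂ Ax Ay) B.vec
        (PhiQuad.kronExpAction₂ Ax Ay B)) ∧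
    -- Kronecker sums in 3D, with one-dimensional exponentials only
    (∀ (Ax : Matrix ιx ιx 𝕜) (Ay : Matrix ιy ιy 𝕜) (Az : Matrix ιz ιz 𝕜)
      (B : ιx → ιy → ιz → 𝕜),
      PhiQuad.kronSum₃ Ax Ay Az ≠ 0 →
      PhiQuad.ErrorBounds p n (PhiQuad.kronSum₃ Ax Ay Az) (PhiQuad.vec₃ B)
        (PhiQuad.kronExpAction₃ Ax Ay Az B)) := by
  refine ⟨fun A b hA => PhiQuad.errorBounds_expAction p n hA b, fun Ax Ay B hA => ?_,
    fun Ax Ay Az B hA => ?_⟩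
  · rw [← PhiQuad.expAction_kronSum₂]
    exact PhiQuad.errorBounds_expAction p n hA _
  · rw [← PhiQuad.expAction_kronSum₃]
    exact PhiQuad.errorBounds_expAction p n hA _
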